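/- Let $\mathbb{Z}^+=\{0,1,2,\dots\}$ and let $\mathbb{P}(\mathbb{Z}^+)$ be the set of probabilities on $\mathbb{Z}^+$, that is, of functions $F:\mathbb{Z}^+\to[0,1]$ with $\sum_{k\ge 0}F(k)=1$. Write $(F*G)(m)=\sum_{k=0}^{m}F(k)\,G(m-k)$ for convolution, let $F^{(n)}$ be the $n$-th convolution power of $F$ (with $F^{(0)}=\delta_0$, the unit mass at $0$), and let $\|F\|_1=\sum_{k\ge 0}|F(k)|$. Define $$\mathcal{A}=\Bigl\{F\in\mathbb{P}(\mathbb{Z}^+) : \sup_{n\ge 1}\, n\,\bigl\|F^{(n)}-F^{(n+1)}\bigr\|_1<\infty\Bigr\}.$$ Then $\mathcal{A}$ is a convex subset of $\mathbb{P}(\mathbb{Z}^+)$. Moreover, for all $F_1,F_2\in\mathcal{A}$ and every $G\in\mathbb{P}(\mathbb{Z}^+)$ one has $F_1*F_2\in\mathcal{A}$ and $$\sum_{k\ge 0}F_1(k)\,G^{(k)}\in\mathcal{A},$$ where the series converges in the norm $\|\cdot\|_1$. -/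

import Mathlib

open scoped ENNReal

namespace RittProb

/-- The set `ℙ(ℤ⁺)` of probabilities on `ℤ⁺ = {0, 1, 2, …}`: nonnegative functions of total mass
`1`. A function on `ℤ⁺` is identified with its extension by zero to `ℤ`. -/
def Prob : Set (ℕ → ℝ) :=
  {F | (∀ k, 0 ≤ F k) ∧ HasSum F 1}

/-- The unit mass at `m`. -/
def dirac (m : ℕ) : ℕ → ℝ := fun k => if k = m then 1 else 0

/-- Convolution, `(F * G)(m) = ∑_k F(k) G(m - k)`. Since both functions vanish at negative
integers, only the finitely many indices `0 ≤ k ≤ m` contribute. -/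
def conv (F G : ℕ → ℝ) : ℕ → ℝ :=
  fun m => ∑ p ∈ Finset.HasAntidiagonal.antidiagonal m, F p.1 * G p.2

/-- The convolution powers `F^{(n)}`, with `F^{(0)} = δ₀`. -/
def convPow (F : ℕ → ℝ) : ℕ → ℕ → ℝ
  | 0 => dirac 0
  | n + 1 => conv F (convPow F n)

/-- The `L¹` norm `∑_k |F(k)|`, with values in `[0, ∞]`. -/
noncomputable def l1Norm (F : ℕ → ℝ) : ℝ≥0∞ := ∑' k, ‖F k‖ₑ

/-- The class `𝒜` of Ritt probabilities:
those `F ∈ ℙ(ℤ⁺)` with `sup_{n ≥ 1} n ‖F^{(n)} - F^{(n+1)}‖ < ∞`. -/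
def classA : Set (ℕ → ℝ) :=
  {F | F ∈ Prob ∧
    ⨆ n : ℕ, ⨆ _ : 1 ≤ n, (n : ℝ≥0∞) * l1Norm (convPow F n - convPow F (n + 1)) < ∞}

/-- The subordinated function `∑_{k ≥ 0} F(k) G^{(k)}`, with the sum taken pointwise. -/
noncomputable def subord (F G : ℕ → ℝ) : ℕ → ℝ :=
  fun m => ∑' k, F k * convPow G k m

end RittProb

/-!
A probability on `ℤ⁺` lies in `𝒜` exactly when it is a Ritt element of the convolution algebra
`ℓ¹(ℤ⁺)`, and Ritt elements behave well in any normed algebra. Products are handled by telescoping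
`fⁿgⁿ - fⁿ⁺¹gⁿ⁺¹`. For `h = a f + b g` one splits `hⁿ - hⁿ⁺¹ = a hⁿ (1 - f) + b hⁿ (1 - g)` and
expands `hⁿ` by the binomial theorem; the identity `(n + 1) C(n, k) = (k + 1) C(n + 1, k + 1)`
converts the weight `n + 1` into the weight `k + 1` of the Ritt condition on `f`. Finally
`f ↦ ∑ₖ f(k) gᵏ` is a bounded algebra homomorphism for every power bounded `g`, so it sends Ritt
elements to Ritt elements.
-/

namespace RittProb

open Finset PowerSeries

lemma sum_antidiagonal_choose_mul_pow_eq_one {R : Type*} [CommSemiring R] {a b : R}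
    (hab : a + b = 1) (n : ℕ) :
    ∑ p ∈ antidiagonal n, n.choose p.1 * (a ^ p.1 * b ^ p.2) = 1 := by
  simpa [hab] using ((Commute.all a b).add_pow' n).symm

section RittElements

variable {A B : Type*}

/-- Power boundedness of an element of a normed ring. -/
def IsPowerBounded [SeminormedRing A] (f : A) : Prop :=
  ∃ M : ℝ, ∀ n, ‖f ^ n‖ ≤ M

/-- Ritt elements of a normed ring, modelled on Ritt operators: power bounded, with
`‖f ^ n - f ^ (n + 1)‖ = O(1 / n)`. The weight `n + 1` in place of `n` includes the case `n = 0`,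
which costs no generality. -/
structure IsRitt [SeminormedRing A] (f : A) : Prop where
  isPowerBounded : IsPowerBounded f
  exists_mul_norm_sub_le : ∃ C : ℝ, ∀ n : ℕ, (n + 1) * ‖f ^ n - f ^ (n + 1)‖ ≤ C

section SeminormedRing

variable [SeminormedRing A]

lemma isPowerBounded_of_norm_le_one {f : A} (hf : ‖f‖ ≤ 1) : IsPowerBounded f := by
  refine ⟨max ‖(1 : A)‖ 1, fun n => ?_⟩
  rcases Nat.eq_zero_or_pos n with rfl | hn
  · simp
  · exact (norm_pow_le' f hn).trans ((pow_le_one₀ (norm_nonneg f) hf).trans (le_max_right _ _))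

lemma IsPowerBounded.isRitt_iff {f : A} (hf : IsPowerBounded f) :
    IsRitt f ↔ ⨆ n : ℕ, ⨆ _ : 1 ≤ n, (n : ℝ≥0∞) * ‖f ^ n - f ^ (n + 1)‖ₑ < ∞ := by
  have enorm_eq (n : ℕ) : (n : ℝ≥0∞) * ‖f ^ n - f ^ (n + 1)‖ₑ
      = ENNReal.ofReal (n * ‖f ^ n - f ^ (n + 1)‖) := by
    rw [ENNReal.ofReal_mul n.cast_nonneg, ENNReal.ofReal_natCast, ofReal_norm]
  simp only [enorm_eq]
  refine ⟨fun ⟨_, C, hC⟩ => ?_, fun h => ⟨hf, ?_⟩⟩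
  · refine (iSup₂_le fun n _ => ENNReal.ofReal_le_ofReal ?_).trans_lt
      (ENNReal.ofReal_lt_top (r := C))
    exact (mul_le_mul_of_nonneg_right (by linarith) (norm_nonneg _)).trans (hC n)
  · set S := ⨆ n : ℕ, ⨆ _ : 1 ≤ n, ENNReal.ofReal (n * ‖f ^ n - f ^ (n + 1)‖)
    have le_S (n : ℕ) (hn : 1 ≤ n) : n * ‖f ^ n - f ^ (n + 1)‖ ≤ S.toReal :=
      (ENNReal.ofReal_le_iff_le_toReal h.ne).1 (le_iSup₂_of_le n hn le_rfl)
    refine ⟨2 * S.toReal + ‖1 - f‖, fun n => ?_⟩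
    rcases Nat.eq_zero_or_pos n with rfl | hn
    · simp
    · have hn' : (n : ℝ) + 1 ≤ 2 * n := by have : (1 : ℝ) ≤ n := mod_cast hn; linarith
      calc (n + 1) * ‖f ^ n - f ^ (n + 1)‖ ≤ 2 * n * ‖f ^ n - f ^ (n + 1)‖ := by gcongr
        _ ≤ 2 * S.toReal + ‖1 - f‖ := by linarith [le_S n hn, norm_nonneg (1 - f)]

end SeminormedRing

lemma IsPowerBounded.map [SeminormedRing A] [SeminormedRing B] [NormedAlgebra ℝ A]
    [NormedAlgebra ℝ B] {f : A} (hf : IsPowerBounded f) (φ : A →A[ℝ] B) :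
    IsPowerBounded (φ f) := by
  obtain ⟨M, hM⟩ := hf
  refine ⟨‖φ.toContinuousLinearMap‖ * M, fun n => ?_⟩
  rw [← map_pow]
  exact φ.toContinuousLinearMap.le_opNorm_of_le (hM n)

lemma IsRitt.map [SeminormedRing A] [SeminormedRing B] [NormedAlgebra ℝ A]
    [NormedAlgebra ℝ B] {f : A} (hf : IsRitt f) (φ : A →A[ℝ] B) : IsRitt (φ f) := by
  obtain ⟨C, hC⟩ := hf.exists_mul_norm_sub_le
  refine ⟨hf.isPowerBounded.map φ, ‖φ.toContinuousLinearMap‖ * C, fun n => ?_⟩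
  rw [← map_pow, ← map_pow, ← map_sub]
  calc (n + 1) * ‖φ (f ^ n - f ^ (n + 1))‖
      ≤ (n + 1) * (‖φ.toContinuousLinearMap‖ * ‖f ^ n - f ^ (n + 1)‖) := by
        gcongr
        exact φ.toContinuousLinearMap.le_opNorm _
    _ = ‖φ.toContinuousLinearMap‖ * ((n + 1) * ‖f ^ n - f ^ (n + 1)‖) := by ring
    _ ≤ ‖φ.toContinuousLinearMap‖ * C := by gcongr; exact hC n

section SeminormedCommRing

variable [SeminormedCommRing A] {f g : A}

lemma IsPowerBounded.mul (hf : IsPowerBounded f) (hg : IsPowerBounded g) :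
    IsPowerBounded (f * g) := by
  obtain ⟨M, hM⟩ := hf
  obtain ⟨N, hN⟩ := hg
  exact ⟨M * N, fun n => mul_pow f g n ▸ norm_mul_le_of_le (hM n) (hN n)⟩

lemma IsRitt.mul (hf : IsRitt f) (hg : IsRitt g) : IsRitt (f * g) := by
  obtain ⟨⟨M, hM⟩, C, hC⟩ := hf
  obtain ⟨⟨N, hN⟩, D, hD⟩ := hg
  refine ⟨.mul ⟨M, hM⟩ ⟨N, hN⟩, C * N + M * D, fun n => ?_⟩
  have telescope : (f * g) ^ n - (f * g) ^ (n + 1)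
      = (f ^ n - f ^ (n + 1)) * g ^ n + f ^ (n + 1) * (g ^ n - g ^ (n + 1)) := by ring
  have hM0 : 0 ≤ M := (norm_nonneg _).trans (hM 0)
  have hN0 : 0 ≤ N := (norm_nonneg _).trans (hN 0)
  calc (n + 1) * ‖(f * g) ^ n - (f * g) ^ (n + 1)‖
      ≤ (n + 1) * (‖f ^ n - f ^ (n + 1)‖ * N + M * ‖g ^ n - g ^ (n + 1)‖) := by
        rw [telescope]
        gcongr
        exact norm_add_le_of_le (norm_mul_le_of_le le_rfl (hN n))
          (norm_mul_le_of_le (hM (n + 1)) le_rfl)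
    _ = (n + 1) * ‖f ^ n - f ^ (n + 1)‖ * N + M * ((n + 1) * ‖g ^ n - g ^ (n + 1)‖) := by ring
    _ ≤ C * N + M * D := by gcongr <;> [exact hC n; exact hD n]

variable [NormedAlgebra ℝ A] {a b : ℝ}

lemma norm_smul_add_smul_pow_mul_le {N : ℝ} (hN : ∀ n, ‖g ^ n‖ ≤ N) (ha : 0 ≤ a) (hb : 0 ≤ b)
    (x : A) (n : ℕ) :
    ‖(a • f + b • g) ^ n * x‖
      ≤ (∑ p ∈ antidiagonal n, n.choose p.1 * (a ^ p.1 * b ^ p.2) * ‖f ^ p.1 * x‖) * N := by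
  have expand : (a • f + b • g) ^ n * x = ∑ p ∈ antidiagonal n,
      (n.choose p.1 * (a ^ p.1 * b ^ p.2)) • (f ^ p.1 * x * g ^ p.2) := by
    rw [(Commute.all _ _).add_pow', sum_mul]
    refine sum_congr rfl fun p _ => ?_
    rw [smul_pow, smul_pow, smul_mul_smul_comm, smul_mul_assoc, smul_mul_assoc, mul_right_comm,
      mul_smul (n.choose p.1 : ℝ), Nat.cast_smul_eq_nsmul]
  rw [expand, sum_mul]
  refine norm_sum_le_of_le _ fun p _ => ?_
  rw [norm_smul_of_nonneg (by positivity), mul_assoc _ _ N]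
  gcongr
  exact norm_mul_le_of_le le_rfl (hN p.2)

lemma IsPowerBounded.smul_add_smul (hf : IsPowerBounded f) (hg : IsPowerBounded g) (ha : 0 ≤ a)
    (hb : 0 ≤ b) (hab : a + b = 1) : IsPowerBounded (a • f + b • g) := by
  obtain ⟨M, hM⟩ := hf
  obtain ⟨N, hN⟩ := hg
  have hN0 : 0 ≤ N := (norm_nonneg _).trans (hN 0)
  refine ⟨M * N, fun n => ?_⟩
  calc ‖(a • f + b • g) ^ n‖
      ≤ (∑ p ∈ antidiagonal n, n.choose p.1 * (a ^ p.1 * b ^ p.2) * ‖f ^ p.1‖) * N := by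
        simpa only [mul_one] using norm_smul_add_smul_pow_mul_le hN ha hb 1 n
    _ ≤ (∑ p ∈ antidiagonal n, n.choose p.1 * (a ^ p.1 * b ^ p.2) * M) * N := by
        gcongr
        exact hM _
    _ = M * N := by rw [← sum_mul, sum_antidiagonal_choose_mul_pow_eq_one hab, one_mul]

lemma add_one_mul_norm_smul_add_smul_pow_mul_le {C N : ℝ}
    (hC : ∀ n : ℕ, (n + 1) * ‖f ^ n - f ^ (n + 1)‖ ≤ C) (hN : ∀ n, ‖g ^ n‖ ≤ N)
    (ha : 0 ≤ a) (hb : 0 ≤ b) (hab : a + b = 1) (n : ℕ) :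
    (n + 1) * ‖(a • f + b • g) ^ n * (a • (1 - f))‖ ≤ C * N := by
  have hN0 : 0 ≤ N := (norm_nonneg _).trans (hN 0)
  have hC0 : 0 ≤ C := le_trans (by positivity) (hC 0)
  have sum_le_one : ∑ p ∈ antidiagonal n,
      (n + 1).choose (p.1 + 1) * (a ^ (p.1 + 1) * b ^ p.2) ≤ 1 := by
    rw [← sum_antidiagonal_choose_mul_pow_eq_one hab (n + 1), Finset.Nat.sum_antidiagonal_succ]
    exact le_add_of_nonneg_left (by positivity)
  have term_le (p : ℕ × ℕ) :
      (n + 1) * (n.choose p.1 * (a ^ p.1 * b ^ p.2) * ‖f ^ p.1 * (a • (1 - f))‖)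
        ≤ (n + 1).choose (p.1 + 1) * (a ^ (p.1 + 1) * b ^ p.2) * C := by
    have choose_eq : ((n : ℝ) + 1) * n.choose p.1 = (n + 1).choose (p.1 + 1) * (p.1 + 1) :=
      mod_cast Nat.add_one_mul_choose_eq n p.1
    rw [mul_smul_comm, norm_smul_of_nonneg ha, mul_one_sub, ← pow_succ]
    calc _ = (n + 1) * n.choose p.1 * (a ^ (p.1 + 1) * b ^ p.2)
              * ‖f ^ p.1 - f ^ (p.1 + 1)‖ := by ring
      _ = (n + 1).choose (p.1 + 1) * (a ^ (p.1 + 1) * b ^ p.2)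
              * ((p.1 + 1) * ‖f ^ p.1 - f ^ (p.1 + 1)‖) := by rw [choose_eq]; ring
      _ ≤ _ := by gcongr; exact hC p.1
  calc _ ≤ (n + 1) * ((∑ p ∈ antidiagonal n,
            n.choose p.1 * (a ^ p.1 * b ^ p.2) * ‖f ^ p.1 * (a • (1 - f))‖) * N) := by
        gcongr
        exact norm_smul_add_smul_pow_mul_le hN ha hb _ n
    _ ≤ (∑ p ∈ antidiagonal n,
            (n + 1).choose (p.1 + 1) * (a ^ (p.1 + 1) * b ^ p.2) * C) * N := by
        rw [← mul_assoc, mul_sum]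
        exact mul_le_mul_of_nonneg_right (sum_le_sum fun p _ => term_le p) hN0
    _ ≤ C * N := by
        rw [← sum_mul]
        gcongr
        exact mul_le_of_le_one_left hC0 sum_le_one

theorem convex_setOf_isRitt : Convex ℝ {f : A | IsRitt f} := by
  rintro f ⟨hf, C, hC⟩ g ⟨hg, D, hD⟩ a b ha hb hab
  obtain ⟨M, hM⟩ := hf
  obtain ⟨N, hN⟩ := hg
  refine ⟨.smul_add_smul ⟨M, hM⟩ ⟨N, hN⟩ ha hb hab, C * N + D * M, fun n => ?_⟩
  have split : (a • f + b • g) ^ n - (a • f + b • g) ^ (n + 1)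
      = (a • f + b • g) ^ n * (a • (1 - f)) + (b • g + a • f) ^ n * (b • (1 - g)) := by
    rw [add_comm (b • g), ← mul_add, pow_succ, ← mul_one_sub, smul_sub, smul_sub,
      sub_add_sub_comm, ← add_smul, hab, one_smul]
  rw [split]
  calc _ ≤ (n + 1) * ‖(a • f + b • g) ^ n * (a • (1 - f))‖
            + (n + 1) * ‖(b • g + a • f) ^ n * (b • (1 - g))‖ := by
        rw [← mul_add]
        gcongr
        exact norm_add_le _ _
    _ ≤ C * N + D * M :=
        add_le_add (add_one_mul_norm_smul_add_smul_pow_mul_le hC hN ha hb hab n)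
          (add_one_mul_norm_smul_add_smul_pow_mul_le hD hM hb ha ((add_comm b a).trans hab) n)

end SeminormedCommRing

end RittElements

/-- The convolution algebra `ℓ¹(ℤ⁺)`. A sequence is encoded by its generating function, so that
convolution is the multiplication of power series. -/
def ellOne : Subalgebra ℝ ℝ⟦X⟧ where
  carrier := {f | Summable fun k => ‖coeff k f‖}
  mul_mem' {f g} hf hg := by
    simpa only [Set.mem_ofPred_eq, coeff_mul] using
      summable_norm_sum_mul_antidiagonal_of_summable_norm hf hg
  add_mem' {f g} hf hg := by
    refine .of_nonneg_of_le (fun _ => norm_nonneg _) (fun k => ?_) (Summable.add hf hg)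
    simpa only [map_add] using norm_add_le (coeff k f) (coeff k g)
  algebraMap_mem' r := by
    refine summable_of_ne_finset_zero (s := {0}) fun k hk => ?_
    simp_all [coeff_C]

namespace ellOne

/-- The sequence with a given generating function. -/
noncomputable def seq : ellOne →ₗ[ℝ] ℕ → ℝ where
  toFun f k := coeff k (f : ℝ⟦X⟧)
  map_add' _ _ := by ext; simp
  map_smul' _ _ := by ext; simp

lemma summable_norm_seq (f : ellOne) : Summable fun k => ‖seq f k‖ := f.2

instance : CanLift (ℕ → ℝ) ellOne seq Summable where
  prf F hF := ⟨⟨PowerSeries.mk F, by simpa [ellOne] using hF.norm⟩, by ext; simp [seq]⟩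

lemma seq_injective : Function.Injective seq := fun _ _ h =>
  Subtype.ext <| PowerSeries.ext fun k => congrFun h k

/-- The identification of `ellOne` with the Banach space `ℓ¹` of sequences, along which the norm
and its completeness are transported. -/
noncomputable def toLp : ellOne ≃ₗ[ℝ] lp (fun _ : ℕ => ℝ) 1 where
  toFun f := ⟨seq f, memℓp_gen (by simpa using summable_norm_seq f)⟩
  invFun F := ⟨PowerSeries.mk F, by simpa [ellOne] using (lp.memℓp F).summable (by simp)⟩
  map_add' f g := Subtype.ext (map_add seq f g)
  map_smul' r f := Subtype.ext (map_smul seq r f)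
  left_inv f := seq_injective (by ext; simp [seq])
  right_inv F := by ext; simp [seq]

noncomputable instance : NormedAddCommGroup ellOne :=
  .induced _ _ toLp.toLinearMap toLp.injective

lemma norm_eq_tsum (f : ellOne) : ‖f‖ = ∑' k, ‖seq f k‖ :=
  (lp.norm_eq_tsum_rpow (by simp) (toLp f)).trans (by simp [toLp])

lemma seq_mul (f g : ellOne) : seq (f * g) = conv (seq f) (seq g) := by
  ext m
  simp [seq, conv, coeff_mul]

lemma seq_one : seq 1 = dirac 0 := by
  ext m
  simp [seq, dirac, coeff_one]

noncomputable instance : NormedCommRing ellOne where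
  __ := (inferInstance : NormedAddCommGroup ellOne)
  __ := (inferInstance : CommRing ellOne)
  norm_mul_le f g := by
    rw [norm_eq_tsum, norm_eq_tsum, norm_eq_tsum,
      tsum_mul_tsum_eq_tsum_sum_antidiagonal_of_summable_norm (summable_norm_seq f).norm
        (summable_norm_seq g).norm]
    refine (summable_norm_seq (f * g)).tsum_le_tsum (fun m => ?_) ?_
    · rw [seq_mul]
      exact norm_sum_le_of_le _ fun p _ => norm_mul_le _ _
    · exact (summable_norm_sum_mul_antidiagonal_of_summable_norm (summable_norm_seq f).norm
        (summable_norm_seq g).norm).of_norm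

noncomputable instance : NormedAlgebra ℝ ellOne where
  norm_smul_le r f := by
    simp only [norm_eq_tsum, map_smul, Pi.smul_apply, norm_smul, tsum_mul_left, le_refl]

instance : CompleteSpace ellOne :=
  (completeSpace_congr (e := toLp.toEquiv)
    (AddMonoidHomClass.isometry_of_norm toLp fun _ => rfl).isUniformEmbedding).2 inferInstance

lemma norm_seq_le (f : ellOne) (k : ℕ) : ‖seq f k‖ ≤ ‖f‖ := by
  rw [norm_eq_tsum]
  exact (summable_norm_seq f).le_tsum k fun _ _ => norm_nonneg _

lemma continuous_seq : Continuous seq :=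
  continuous_pi fun k => AddMonoidHomClass.continuous_of_bound
    ((LinearMap.proj k).comp seq) 1 fun f => by simpa using norm_seq_le f k

end ellOne

section FunctionalCalculus

open ellOne

variable {A B : Type*}

lemma norm_seq_smul_pow_le [SeminormedRing A] [NormedAlgebra ℝ A] {g : A} {M : ℝ}
    (hM : ∀ n, ‖g ^ n‖ ≤ M) (f : ellOne) (k : ℕ) :
    ‖seq f k • g ^ k‖ ≤ ‖seq f k‖ * M := by
  rw [norm_smul]
  gcongr
  exact hM k

lemma IsPowerBounded.summable_norm_seq_smul_pow [SeminormedRing A] [NormedAlgebra ℝ A] {g : A}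
    (hg : IsPowerBounded g) (f : ellOne) :
    Summable fun k => ‖seq f k • g ^ k‖ := by
  obtain ⟨M, hM⟩ := hg
  exact .of_nonneg_of_le (fun _ => norm_nonneg _) (norm_seq_smul_pow_le hM f)
    ((summable_norm_seq f).mul_right M)

variable [NormedRing A] [NormedAlgebra ℝ A] [CompleteSpace A]
  [NormedRing B] [NormedAlgebra ℝ B] [CompleteSpace B] {g : A}

/-- The underlying linear map of `IsPowerBounded.aeval`. -/
noncomputable def IsPowerBounded.aevalCLM (hg : IsPowerBounded g) : ellOne →L[ℝ] A :=
  LinearMap.mkContinuousOfExistsBound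
    { toFun f := ∑' k, seq f k • g ^ k
      map_add' f₁ f₂ := by
        simp only [map_add, Pi.add_apply, add_smul]
        exact (hg.summable_norm_seq_smul_pow f₁).of_norm.tsum_add
          (hg.summable_norm_seq_smul_pow f₂).of_norm
      map_smul' r f := by
        simp only [map_smul, Pi.smul_apply, smul_assoc, RingHom.id_apply]
        exact (hg.summable_norm_seq_smul_pow f).of_norm.tsum_const_smul r }
    (by
      obtain ⟨M, hM⟩ := hg
      refine ⟨M, fun f => ?_⟩
      rw [mul_comm, norm_eq_tsum, ← tsum_mul_right]
      exact tsum_of_norm_bounded ((summable_norm_seq f).mul_right M).hasSum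
        (norm_seq_smul_pow_le hM f))

lemma IsPowerBounded.hasSum_aevalCLM (hg : IsPowerBounded g) (f : ellOne) :
    HasSum (fun k => seq f k • g ^ k) (hg.aevalCLM f) :=
  (hg.summable_norm_seq_smul_pow f).of_norm.hasSum

lemma IsPowerBounded.aevalCLM_one (hg : IsPowerBounded g) : hg.aevalCLM 1 = 1 := by
  refine (hg.hasSum_aevalCLM 1).unique ?_
  convert hasSum_ite_eq 0 (1 : A) using 2 with k
  rcases eq_or_ne k 0 with rfl | hk <;> simp [seq_one, dirac, *]

lemma IsPowerBounded.aevalCLM_mul (hg : IsPowerBounded g) (f₁ f₂ : ellOne) :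
    hg.aevalCLM (f₁ * f₂) = hg.aevalCLM f₁ * hg.aevalCLM f₂ := by
  rw [← (hg.hasSum_aevalCLM _).tsum_eq, ← (hg.hasSum_aevalCLM f₁).tsum_eq,
    ← (hg.hasSum_aevalCLM f₂).tsum_eq, tsum_mul_tsum_eq_tsum_sum_antidiagonal_of_summable_norm
      (hg.summable_norm_seq_smul_pow f₁) (hg.summable_norm_seq_smul_pow f₂)]
  refine tsum_congr fun n => ?_
  rw [seq_mul, conv, sum_smul]
  refine sum_congr rfl fun p hp => ?_
  rw [smul_mul_smul_comm, ← pow_add, mem_antidiagonal.1 hp]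

/-- The functional calculus `f ↦ ∑ₖ f(k) gᵏ` of a power bounded element `g`, from the convolution
algebra `ℓ¹(ℤ⁺)` to a Banach algebra. -/
noncomputable def IsPowerBounded.aeval (hg : IsPowerBounded g) : ellOne →A[ℝ] A where
  toAlgHom := AlgHom.ofLinearMap hg.aevalCLM.toLinearMap hg.aevalCLM_one hg.aevalCLM_mul
  cont := hg.aevalCLM.continuous

lemma IsPowerBounded.hasSum_aeval (hg : IsPowerBounded g) (f : ellOne) :
    HasSum (fun k => seq f k • g ^ k) (hg.aeval f) :=
  hg.hasSum_aevalCLM f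

lemma IsPowerBounded.map_aeval (hg : IsPowerBounded g) (φ : A →A[ℝ] B) (f : ellOne) :
    φ (hg.aeval f) = (hg.map φ).aeval f := by
  refine HasSum.unique ?_ ((hg.map φ).hasSum_aeval f)
  simpa [Function.comp_def] using (hg.hasSum_aeval f).map φ φ.continuous

lemma IsPowerBounded.tendsto_enorm_aeval_sub_sum (hg : IsPowerBounded g) (f : ellOne) :
    Filter.Tendsto (fun N => ‖hg.aeval f - ∑ k ∈ range N, seq f k • g ^ k‖ₑ)
      Filter.atTop (nhds 0) := by
  simpa using ((hg.hasSum_aeval f).tendsto_sum_nat.const_sub (hg.aeval f)).enorm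

end FunctionalCalculus

namespace ellOne

variable {f g : ellOne}

lemma seq_pow (f : ellOne) (n : ℕ) : seq (f ^ n) = convPow (seq f) n := by
  induction n with
  | zero => exact seq_one
  | succ n ih => rw [pow_succ', seq_mul, ih, convPow]

lemma l1Norm_seq (f : ellOne) : l1Norm (seq f) = ‖f‖ₑ := by
  rw [← ofReal_norm, norm_eq_tsum,
    ENNReal.ofReal_tsum_of_nonneg (fun _ => norm_nonneg _) (summable_norm_seq f)]
  simp only [ofReal_norm, l1Norm]

lemma subord_seq (hg : IsPowerBounded g) (f : ellOne) :
    subord (seq f) (seq g) = seq (hg.aeval f) := by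
  have h := (hg.hasSum_aeval f).map seq continuous_seq
  ext m
  simpa [subord, seq_pow] using (Pi.hasSum.1 h m).tsum_eq

/-- The total mass `∑ₖ f(k)`, which is multiplicative because it is the functional calculus
at `1`. -/
noncomputable def mass : ellOne →A[ℝ] ℝ :=
  (isPowerBounded_of_norm_le_one (norm_one (α := ℝ)).le).aeval

lemma hasSum_mass (f : ellOne) : HasSum (seq f) (mass f) := by
  have h := (isPowerBounded_of_norm_le_one (norm_one (α := ℝ)).le).hasSum_aeval f
  simp only [one_pow, smul_eq_mul, mul_one] at h
  exact h

lemma seq_mem_prob_iff : seq f ∈ Prob ↔ (∀ k, 0 ≤ seq f k) ∧ mass f = 1 :=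
  and_congr_right fun _ => ⟨(hasSum_mass f).unique, fun h => h ▸ hasSum_mass f⟩

lemma norm_eq_one_of_mem_prob (hf : seq f ∈ Prob) : ‖f‖ = 1 := by
  simp_rw [norm_eq_tsum, Real.norm_of_nonneg (hf.1 _), hf.2.tsum_eq]

lemma isPowerBounded_of_mem_prob (hf : seq f ∈ Prob) : IsPowerBounded f :=
  isPowerBounded_of_norm_le_one (norm_eq_one_of_mem_prob hf).le

lemma seq_one_mem_prob : seq 1 ∈ Prob := by
  rw [seq_one]
  exact ⟨fun k => ite_nonneg zero_le_one le_rfl, hasSum_ite_eq 0 1⟩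

lemma seq_mul_mem_prob (hf : seq f ∈ Prob) (hg : seq g ∈ Prob) : seq (f * g) ∈ Prob := by
  rw [seq_mem_prob_iff] at *
  refine ⟨fun m => ?_, by rw [map_mul, hf.2, hg.2, one_mul]⟩
  rw [seq_mul]
  exact sum_nonneg fun p _ => mul_nonneg (hf.1 _) (hg.1 _)

lemma seq_pow_mem_prob (hf : seq f ∈ Prob) (n : ℕ) : seq (f ^ n) ∈ Prob := by
  induction n with
  | zero => exact pow_zero f ▸ seq_one_mem_prob
  | succ n ih => exact pow_succ f n ▸ seq_mul_mem_prob ih hf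

lemma seq_aeval_mem_prob (hf : seq f ∈ Prob) (hg : seq g ∈ Prob) (hg' : IsPowerBounded g) :
    seq (hg'.aeval f) ∈ Prob := by
  refine seq_mem_prob_iff.2 ⟨fun m => ?_, ?_⟩
  · rw [← subord_seq]
    exact tsum_nonneg fun k => mul_nonneg (hf.1 k) (seq_pow g k ▸ (seq_pow_mem_prob hg k).1 m)
  · refine (hg'.map_aeval mass f).trans (((hg'.map mass).hasSum_aeval f).unique ?_)
    simpa [(seq_mem_prob_iff.1 hg).2] using hf.2

lemma seq_mem_classA_iff : seq f ∈ classA ↔ seq f ∈ Prob ∧ IsRitt f :=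
  and_congr_right fun hf => by
    simp only [(isPowerBounded_of_mem_prob hf).isRitt_iff, ← seq_pow, ← map_sub, l1Norm_seq]

end ellOne

open ellOne

lemma convex_prob : Convex ℝ Prob := by
  intro F hF G hG a b ha hb hab
  refine ⟨fun k => add_nonneg (mul_nonneg ha (hF.1 k)) (mul_nonneg hb (hG.1 k)), ?_⟩
  have h := (hF.2.mul_left a).add (hG.2.mul_left b)
  rwa [mul_one, mul_one, hab] at h

theorem convex_classA : Convex ℝ classA := by
  intro F hF G hG a b ha hb hab
  lift F to ellOne using hF.1.2.summable with f
  lift G to ellOne using hG.1.2.summable with g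
  rw [seq_mem_classA_iff] at hF hG
  rw [← map_smul, ← map_smul, ← map_add, seq_mem_classA_iff]
  exact ⟨by simpa using convex_prob hF.1 hG.1 ha hb hab,
    convex_setOf_isRitt hF.2 hG.2 ha hb hab⟩

theorem conv_mem_classA {F G : ℕ → ℝ} (hF : F ∈ classA) (hG : G ∈ classA) :
    conv F G ∈ classA := by
  lift F to ellOne using hF.1.2.summable with f
  lift G to ellOne using hG.1.2.summable with g
  rw [seq_mem_classA_iff] at hF hG
  rw [← seq_mul, seq_mem_classA_iff]
  exact ⟨seq_mul_mem_prob hF.1 hG.1, hF.2.mul hG.2⟩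

theorem tendsto_l1Norm_subord_sub_sum {F G : ℕ → ℝ} (hF : Summable F) (hG : G ∈ Prob) :
    Filter.Tendsto (fun N => l1Norm (subord F G - ∑ k ∈ range N, F k • convPow G k))
      Filter.atTop (nhds 0) := by
  lift F to ellOne using hF with f
  lift G to ellOne using hG.2.summable with g
  have hg := isPowerBounded_of_mem_prob hG
  simp only [subord_seq hg, ← seq_pow, ← map_smul, ← map_sum, ← map_sub, l1Norm_seq]
  exact hg.tendsto_enorm_aeval_sub_sum f

theorem subord_mem_classA {F G : ℕ → ℝ} (hF : F ∈ classA) (hG : G ∈ Prob) :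
    subord F G ∈ classA := by
  lift F to ellOne using hF.1.2.summable with f
  lift G to ellOne using hG.2.summable with g
  have hg := isPowerBounded_of_mem_prob hG
  rw [seq_mem_classA_iff] at hF
  rw [subord_seq hg, seq_mem_classA_iff]
  exact ⟨seq_aeval_mem_prob hF.1 hG hg, hF.2.map hg.aeval⟩

end RittProb

theorem proposition4p2 :
    (RittProb.classA ⊆ RittProb.Prob ∧ Convex ℝ RittProb.classA) ∧
    (∀ F₁ ∈ RittProb.classA, ∀ F₂ ∈ RittProb.classA,
      RittProb.conv F₁ F₂ ∈ RittProb.classA) ∧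
    (∀ F₁ ∈ RittProb.classA, ∀ G ∈ RittProb.Prob,
      Filter.Tendsto
        (fun N : ℕ => RittProb.l1Norm
          (RittProb.subord F₁ G - ∑ k ∈ Finset.range N, F₁ k • RittProb.convPow G k))
        Filter.atTop (nhds 0) ∧
      RittProb.subord F₁ G ∈ RittProb.classA) :=
  ⟨⟨fun _ hF => hF.1, RittProb.convex_classA⟩,
    fun _ hF₁ _ hF₂ => RittProb.conv_mem_classA hF₁ hF₂,
    fun _ hF₁ _ hG =>
      ⟨RittProb.tendsto_l1Norm_subord_sub_sum hF₁.1.2.summable hG,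
        RittProb.subord_mem_classA hF₁ hG⟩⟩
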